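/- Let $\kappa,\sigma,\sigma_n>0$ and $\theta\in\mathbb R$. Let $(X_t)_{t\ge 0}$ be the Ornstein–Uhlenbeck process with continuous paths solving $dX_t=\kappa(\theta-X_t)\,dt+\sigma\,dW_t$, where $W$ is a standard Brownian motion and $X_0\sim\mathcal N(\theta,\sigma^2/(2\kappa))$ is independent of $W$. Let $1\le m\le n$, let $0\le t_1<\dots<t_n$ be sampling times and $t'_1<\dots<t'_n$ reception times with $t_i<t'_i$ for all $i$, and let $t>t'_n$ (all times deterministic). The observations are $Y_{t'_i}=X_{t_i}+N_{t'_i}$, where $N_{t'_1},\dots,N_{t'_n}$ are i.i.d. $\mathcal N(0,\sigma_n^2)$ random variables, independent of the process $X$. The value of information is the mutual information (in nats) $$v(t)=I\big(X_t;\,Y_{t'_n},\dots,Y_{t'_{n-m+1}}\big).$$ Let $\mathbf\Sigma_{\mathbf X}$ be the covariance matrix of $(X_{t_{n-m+1}},\dots,X_{t_n})^{\mathsf T}$, let $\mathbf A=\sigma_n^2\mathbf\Sigma_{\mathbf X}^{-1}+\mathbf I$ (an $m\times m$ matrix), let $\mathbf A_{mm}$ be the $(m-1)\times(m-1)$ matrix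 obtained from $\mathbf A$ by removing its last row and last column (with $\det\mathbf A_{mm}=1$ if $m=1$), and let $\gamma=\frac{\sigma^2}{2\kappa\sigma_n^2}$. Then $\operatorname{Var}[X_{t_i}]/\operatorname{Var}[N_{t'_i}]=\gamma$ for all $i$, the matrices $\mathbf\Sigma_{\mathbf X}$ and $\mathbf A$ are invertible, $v(t)$ is finite, and $$v(t)=\frac12\log\left(\frac{1}{1-e^{-2\kappa(t-t_n)}}\right)-\frac12\log\left(1+\frac{1}{e^{2\kappa(t-t_n)}-1}\cdot\frac{\det(\mathbf A_{mm})}{\gamma\det(\mathbf A)}\right).$$ -/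

import Mathlib

open MeasureTheory ProbabilityTheory
open scoped NNReal ENNReal

/-- The mutual information `I(U; V)` (in nats) of two random variables: the Kullback–Leibler
divergence of the joint law from the product of the marginal laws. -/
noncomputable def mutualInfo {Ω E F : Type*} [MeasurableSpace Ω] [MeasurableSpace E]
    [MeasurableSpace F] (U : Ω → E) (V : Ω → F) (P : Measure Ω) : ℝ≥0∞ :=
  InformationTheory.klDiv (P.map fun ω => (U ω, V ω)) ((P.map U).prod (P.map V))

/-- `X` solves the Ornstein–Uhlenbeck equation `dX = κ (θ - X) dt + σ dW`, where `W` is a standard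
Brownian motion, with initial value `X 0` independent of `W` and of law `N(θ, σ² / (2κ))`.
Since the diffusion coefficient is the constant `σ`, the stochastic integral `∫₀ᵗ σ dW` is
`σ * W t` (and `W 0 = 0` almost surely). -/
structure IsStationaryOU {Ω : Type*} [MeasurableSpace Ω] (κ θ σ : ℝ) (W X : ℝ≥0 → Ω → ℝ)
    (P : Measure Ω) : Prop where
  brownian : IsBrownianReal W P
  aemeasurable : ∀ t, AEMeasurable (X t) P
  initial : HasLaw (X 0) (gaussianReal θ (σ ^ 2 / (2 * κ)).toNNReal) P
  indep : IndepFun (X 0) (fun ω t => W t ω) P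
  continuous_paths : ∀ᵐ ω ∂P, Continuous fun t => X t ω
  sde : ∀ᵐ ω ∂P, ∀ t : ℝ≥0,
    X t ω = X 0 ω + (∫ s in (0 : ℝ)..(t : ℝ), κ * (θ - X s.toNNReal ω)) + σ * W t ω

/-- The noise values `N (τ' i)`, `1 ≤ i ≤ n`, are i.i.d. with law `N(0, σn²)`, and they are
independent of the process `X`. -/
structure IsChannelNoise {Ω : Type*} [MeasurableSpace Ω] (σn : ℝ) (n : ℕ) (τ' : ℕ → ℝ≥0)
    (X N : ℝ≥0 → Ω → ℝ) (P : Measure Ω) : Prop where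
  law : ∀ i ∈ Set.Icc 1 n, HasLaw (N (τ' i)) (gaussianReal 0 (σn ^ 2).toNNReal) P
  iIndep : iIndepFun (fun i : Set.Icc 1 n => N (τ' i)) P
  indep : IndepFun (fun ω s => X s ω) (fun ω (i : Set.Icc 1 n) => N (τ' i) ω) P

/-- The observation `Y_{τ' i} = X_{τ i} + N_{τ' i}`. -/
def observation {Ω : Type*} (τ τ' : ℕ → ℝ≥0) (X N : ℝ≥0 → Ω → ℝ) (i : ℕ) (ω : Ω) : ℝ :=
  X (τ i) ω + N (τ' i) ω

/-- The `j`-th index (`j = 0, …, m - 1`) of the window `n - m + 1, …, n`; used for `m ≤ n`. -/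
def windowIndex (n m : ℕ) (j : Fin m) : ℕ := n - m + 1 + j

/-- The value of information
`v(t) = I(X_t; Y_{τ' n}, …, Y_{τ' (n - m + 1)})` of the `m` most recent of `n` observations. -/
noncomputable def valueOfInformation {Ω : Type*} [MeasurableSpace Ω] (n m : ℕ) (τ τ' : ℕ → ℝ≥0)
    (X N : ℝ≥0 → Ω → ℝ) (P : Measure Ω) (t : ℝ≥0) : ℝ≥0∞ :=
  mutualInfo (X t) (fun ω (j : Fin m) => observation τ τ' X N (windowIndex n m j) ω) P

/-- The covariance matrix `Σ_X` of `(X_{τ (n - m + 1)}, …, X_{τ n})`. -/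
noncomputable def sampleCovariance {Ω : Type*} [MeasurableSpace Ω] (n m : ℕ) (τ : ℕ → ℝ≥0)
    (X : ℝ≥0 → Ω → ℝ) (P : Measure Ω) : Matrix (Fin m) (Fin m) ℝ :=
  Matrix.of fun i j => cov[X (τ (windowIndex n m i)), X (τ (windowIndex n m j)); P]

/-- The matrix `A = σn² Σ_X⁻¹ + I`. -/
noncomputable def matrixA {Ω : Type*} [MeasurableSpace Ω] (σn : ℝ) (n m : ℕ) (τ : ℕ → ℝ≥0)
    (X : ℝ≥0 → Ω → ℝ) (P : Measure Ω) : Matrix (Fin m) (Fin m) ℝ :=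
  σn ^ 2 • (sampleCovariance n m τ X P)⁻¹ + 1

/-- The `(m - 1) × (m - 1)` matrix obtained by removing the last row and the last column. -/
def removeLast {m : ℕ} (A : Matrix (Fin m) (Fin m) ℝ) : Matrix (Fin (m - 1)) (Fin (m - 1)) ℝ :=
  A.submatrix (Fin.castLE (Nat.sub_le m 1)) (Fin.castLE (Nat.sub_le m 1))

/-!
Multiplied by the integrating factor `e^{κt}`, the Ornstein–Uhlenbeck process is a pathwise limit of
finite Riemann–Stieltjes sums against the Brownian motion. Hence it is a Gaussian process, with
covariance `σ² / (2κ) · e^{-κ|s-t|}`. If a Gaussian variable `U` is the sum of a function of `V` and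
of a Gaussian residual `R` independent of `V`, then the density of the law of `(U, V)` with respect
to the product of its marginals is a ratio of Gaussian densities, and
`I(U; V) = ½ log (Var U / Var R)`. For `U = X_t` and `V` the window of observations, the Markov
property turns the normal equations of the linear regression of `U` on `V` into
`(Σ_X + σn² I) c = e^{-κ(t - t_n)} Σ_X e_m`, which are solved by `c = e^{-κ(t - t_n)} A⁻¹ e_m`. The
residual variance therefore involves only the last diagonal entry `det A_mm / det A` of `A⁻¹`.
-/

open Filter Topology

section GaussianProcess

variable {Ω T : Type*} [MeasurableSpace Ω] {P : Measure Ω}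

lemma hasLaw_gaussianReal_of_tendsto [IsProbabilityMeasure P] {Y : ℕ → Ω → ℝ} {Z : Ω → ℝ}
    {μ : ℕ → ℝ} {v : ℕ → ℝ≥0} {μ' : ℝ} {v' : ℝ≥0}
    (hY : ∀ k, HasLaw (Y k) (gaussianReal (μ k) (v k)) P)
    (hlim : ∀ᵐ ω ∂P, Tendsto (fun k => Y k ω) atTop (𝓝 (Z ω)))
    (hμ : Tendsto μ atTop (𝓝 μ')) (hv : Tendsto v atTop (𝓝 v')) :
    HasLaw Z (gaussianReal μ' v') P := by
  have hYm k := (hY k).aemeasurable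
  have hZ : AEMeasurable Z P := aemeasurable_of_tendsto_metrizable_ae' hYm hlim
  have : IsProbabilityMeasure (P.map Z) := Measure.isProbabilityMeasure_map hZ
  refine ⟨hZ, Measure.ext_of_charFun (funext fun u => ?_)⟩
  have hdist := ProbabilityMeasure.tendsto_iff_tendsto_charFun.1
    (tendstoInDistribution_of_ae_tendsto hYm hZ hlim).tendsto u
  have hexp : Tendsto (fun k => Complex.exp (u * μ k * Complex.I - (v k : ℝ) * u ^ 2 / 2)) atTop
      (𝓝 (Complex.exp (u * μ' * Complex.I - (v' : ℝ) * u ^ 2 / 2))) :=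
    (((hμ.ofReal.const_mul _).mul_const _).sub
      (((NNReal.tendsto_coe.2 hv).ofReal.mul_const _).div_const _)).cexp
  simp only [ProbabilityMeasure.coe_mk, (hY _).map_eq, charFun_gaussianReal] at hdist
  rw [tendsto_nhds_unique hdist hexp, charFun_gaussianReal]

lemma isGaussianProcess_of_forall_sum {X : T → Ω → ℝ}
    (h : ∀ (I : Finset T) (c : T → ℝ), HasGaussianLaw (fun ω => ∑ i ∈ I, c i * X i ω) P) :
    IsGaussianProcess X P where
  hasGaussianLaw I := by
    classical
    have hX : ∀ t, AEMeasurable (X t) P := fun t => by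
      simpa using (h {t} fun _ => 1).aemeasurable
    have hm : AEMeasurable (fun ω => I.restrict (X · ω)) P :=
      aemeasurable_pi_lambda _ fun i => hX i
    refine ⟨isGaussian_of_map_eq_gaussianReal fun L => ?_⟩
    let c : T → ℝ := fun t => if ht : t ∈ I then L (Pi.single ⟨t, ht⟩ 1) else 0
    have hL : (L ∘ fun ω => I.restrict (X · ω)) = fun ω => ∑ i ∈ I, c i * X i ω := by
      ext ω
      have hsum := L.toLinearMap.pi_apply_eq_sum_univ (I.restrict (X · ω))
      simp only [ContinuousLinearMap.coe_coe, smul_eq_mul] at hsum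
      rw [Function.comp_apply, hsum, ← Finset.sum_coe_sort I]
      refine Finset.sum_congr rfl fun i _ => ?_
      rw [mul_comm, Finset.restrict]
      congr 1
      simp only [c, dif_pos i.2]
      congr 1
      ext j
      simp [Pi.single_apply, eq_comm]
    rw [AEMeasurable.map_map_of_aemeasurable (by fun_prop) hm, hL]
    exact ⟨_, _, (h I c).map_eq_gaussianReal⟩

lemma hasGaussianLaw_of_mem_span {X : T → Ω → ℝ} (hX : IsGaussianProcess X P) {Y : Ω → ℝ}
    (hY : Y ∈ Submodule.span ℝ (Set.range X)) : HasGaussianLaw Y P := by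
  obtain ⟨c, rfl⟩ := Finsupp.mem_span_range_iff_exists_finsupp.1 hY
  exact (hX.smul c).hasGaussianLaw_sum

lemma isGaussianProcess_of_mem_span {S : Type*} {X : T → Ω → ℝ} (hX : IsGaussianProcess X P)
    {Y : S → Ω → ℝ} (hY : ∀ s, Y s ∈ Submodule.span ℝ (Set.range X)) :
    IsGaussianProcess Y P := by
  refine isGaussianProcess_of_forall_sum fun I c => ?_
  have hsum : (fun ω => ∑ i ∈ I, c i * Y i ω) = ∑ i ∈ I, c i • Y i := by ext ω; simp
  rw [hsum]
  exact hasGaussianLaw_of_mem_span hX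
    (Submodule.sum_mem _ fun i _ => Submodule.smul_mem _ _ (hY i))

lemma isGaussianProcess_add_const {X : T → Ω → ℝ} (hX : IsGaussianProcess X P) (a : ℝ) :
    IsGaussianProcess (fun t ω => X t ω + a) P := by
  refine isGaussianProcess_of_forall_sum fun I c => ?_
  have hlaw : HasGaussianLaw (fun ω => ∑ i ∈ I, c i * X i ω) P :=
    (hX.smul c).hasGaussianLaw_fun_sum
  have hshift := gaussianReal_add_const ⟨hlaw.aemeasurable, hlaw.map_eq_gaussianReal⟩
    (∑ i ∈ I, c i * a)
  simpa only [mul_add, Finset.sum_add_distrib] using hshift.hasGaussianLaw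

lemma isGaussianProcess_sumElim {S : Type*} {X : S → Ω → ℝ} {Y : T → Ω → ℝ}
    (hX : IsGaussianProcess X P) (hY : IsGaussianProcess Y P)
    (h : IndepFun (fun ω s => X s ω) (fun ω t => Y t ω) P) :
    IsGaussianProcess (Sum.elim X Y) P := by
  refine isGaussianProcess_of_forall_sum fun I c => ?_
  have hXsum : HasGaussianLaw (fun ω => ∑ i ∈ I.toLeft, c (.inl i) * X i ω) P :=
    (hX.smul fun i => c (.inl i)).hasGaussianLaw_fun_sum
  have hYsum : HasGaussianLaw (fun ω => ∑ i ∈ I.toRight, c (.inr i) * Y i ω) P :=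
    (hY.smul fun i => c (.inr i)).hasGaussianLaw_fun_sum
  have hind : IndepFun (fun ω => ∑ i ∈ I.toLeft, c (.inl i) * X i ω)
      (fun ω => ∑ i ∈ I.toRight, c (.inr i) * Y i ω) P :=
    h.comp (φ := fun x : S → ℝ => ∑ i ∈ I.toLeft, c (.inl i) * x i)
      (ψ := fun y : T → ℝ => ∑ i ∈ I.toRight, c (.inr i) * y i) (by fun_prop) (by fun_prop)
  have hsplit ω : ∑ i ∈ I, c i * Sum.elim X Y i ω =
      ∑ i ∈ I.toLeft, c (.inl i) * X i ω + ∑ i ∈ I.toRight, c (.inr i) * Y i ω := by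
    conv_lhs => rw [← I.toLeft_disjSum_toRight, Finset.sum_disjSum]
    rfl
  simpa only [hsplit] using (hind.hasGaussianLaw hXsum hYsum).fun_add

section Limit

variable {X : ℕ → T → Ω → ℝ} {Z : T → Ω → ℝ} {μ : T → ℝ} {C : T → T → ℝ}
  (hX : ∀ k, IsGaussianProcess (X k) P)
  (hlim : ∀ t, ∀ᵐ ω ∂P, Tendsto (fun k => X k t ω) atTop (𝓝 (Z t ω)))
  (hμ : ∀ t, Tendsto (fun k => P[X k t]) atTop (𝓝 (μ t)))
  (hC : ∀ s t, Tendsto (fun k => cov[X k s, X k t; P]) atTop (𝓝 (C s t)))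

include hX hlim hμ hC

lemma hasLaw_sum_gaussianReal_of_tendsto [Fintype T] :
    HasLaw (fun ω => ∑ t, Z t ω) (gaussianReal (∑ t, μ t) (∑ s, ∑ t, C s t).toNNReal) P := by
  have hP : IsProbabilityMeasure P := (hX 0).isProbabilityMeasure
  have hX2 k t : MemLp (X k t) 2 P := ((hX k).hasGaussianLaw_eval t).memLp_two
  have hlaw k : HasGaussianLaw (fun ω => ∑ t, X k t ω) P := (hX k).hasGaussianLaw_fun_sum
  refine hasLaw_gaussianReal_of_tendsto
    (fun k => ⟨(hlaw k).aemeasurable, (hlaw k).map_eq_gaussianReal⟩) ?_ ?_ ?_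
  · filter_upwards [ae_all_iff.2 hlim] with ω hω
    exact tendsto_finsetSum _ fun t _ => hω t
  · simp only [integral_finsetSum _ fun t _ => (hX2 _ t).integrable one_le_two]
    exact tendsto_finsetSum _ fun t _ => hμ t
  · refine (continuous_real_toNNReal.tendsto _).comp ?_
    simp only [variance_fun_sum (hX2 _)]
    exact tendsto_finsetSum _ fun s _ => tendsto_finsetSum _ fun t _ => hC s t

lemma variance_sum_of_tendsto [Fintype T] :
    Var[fun ω => ∑ t, Z t ω; P] = ∑ s, ∑ t, C s t := by
  have hP : IsProbabilityMeasure P := (hX 0).isProbabilityMeasure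
  have hX2 k t : MemLp (X k t) 2 P := ((hX k).hasGaussianLaw_eval t).memLp_two
  have hC0 : 0 ≤ ∑ s, ∑ t, C s t := by
    refine ge_of_tendsto' (tendsto_finsetSum _ fun s _ => tendsto_finsetSum _ fun t _ => hC s t)
      fun k => ?_
    rw [← variance_fun_sum (hX2 k)]
    exact variance_nonneg _ _
  rw [(hasLaw_sum_gaussianReal_of_tendsto hX hlim hμ hC).variance_eq, variance_id_gaussianReal,
    Real.coe_toNNReal _ hC0]

lemma isGaussianProcess_of_tendsto : IsGaussianProcess Z P := by
  refine isGaussianProcess_of_forall_sum fun I c => ?_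
  have hlaw := hasLaw_sum_gaussianReal_of_tendsto (T := I) (X := fun k i ω => c i * X k i ω)
    (Z := fun i ω => c i * Z i ω) (fun k => ((hX k).smul c).comp_right _)
    (fun i => (hlim i).mono fun ω hω => hω.const_mul (c i))
    (fun i => by simpa only [integral_const_mul] using (hμ i).const_mul (c i))
    (fun i j => by
      simpa only [covariance_const_mul_left, covariance_const_mul_right] using
        ((hC i j).const_mul (c i)).const_mul (c j))
  have hsum ω : ∑ i : I, c i * Z i ω = ∑ i ∈ I, c i * Z i ω :=
    Finset.sum_coe_sort I fun i => c i * Z i ω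
  simpa only [hsum] using hlaw.hasGaussianLaw

lemma covariance_eq_of_tendsto (s t : T) : cov[Z s, Z t; P] = C s t := by
  have hP : IsProbabilityMeasure P := (hX 0).isProbabilityMeasure
  have hZ2 t : MemLp (Z t) 2 P :=
    ((isGaussianProcess_of_tendsto hX hlim hμ hC).hasGaussianLaw_eval t).memLp_two
  have hsymm : C s t = C t s :=
    tendsto_nhds_unique (hC s t) (by simpa only [covariance_comm (X _ s)] using hC t s)
  have hvar {n : ℕ} (f : Fin n → T) : Var[fun ω => ∑ i, Z (f i) ω; P] = ∑ i, ∑ j, C (f i) (f j) :=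
    variance_sum_of_tendsto (fun k => (hX k).comp_right f) (fun i => hlim (f i))
      (fun i => hμ (f i)) fun i j => hC (f i) (f j)
  have hs := hvar ![s]
  have ht := hvar ![t]
  have hst := hvar ![s, t]
  simp only [Fin.sum_univ_two, Fin.sum_univ_one, Matrix.cons_val_zero, Matrix.cons_val_one]
    at hs ht hst
  rw [variance_fun_add (hZ2 s) (hZ2 t)] at hst
  linarith

end Limit

end GaussianProcess

section GridSum

variable {E : Type*} [AddCommGroup E] [Module ℝ E]

/-- The Riemann–Stieltjes sum of `∫ f dv` over `[0, t]` for the grid of mesh `1 / k`, with `f`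
evaluated at the right end point of each cell; the incomplete last cell is left out. It
approximates the Wiener integral of a deterministic `f` when `v` is a Brownian motion. -/
noncomputable def gridSum (f : ℝ≥0 → ℝ) (v : ℝ≥0 → E) (k : ℕ) (t : ℝ≥0) : E :=
  ∑ j ∈ Finset.range ⌊t * k⌋₊, f ((j + 1) / k) • (v ((j + 1) / k) - v (j / k))

lemma gridSum_mem_span (f : ℝ≥0 → ℝ) (v : ℝ≥0 → E) (k : ℕ) (t : ℝ≥0) :
    gridSum f v k t ∈ Submodule.span ℝ (Set.range v) :=
  Submodule.sum_mem _ fun _ _ => Submodule.smul_mem _ _ <|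
    Submodule.sub_mem _ (Submodule.subset_span ⟨_, rfl⟩) (Submodule.subset_span ⟨_, rfl⟩)

lemma gridSum_apply {Ω : Type*} (f : ℝ≥0 → ℝ) (v : ℝ≥0 → Ω → ℝ) (k : ℕ) (t : ℝ≥0) (ω : Ω) :
    gridSum f v k t ω = gridSum f (v · ω) k t := by
  simp [gridSum]

variable {f v M : ℝ≥0 → ℝ} {t : ℝ≥0}

lemma floor_mul_div_le (t : ℝ≥0) (k : ℕ) : (⌊t * k⌋₊ / k : ℝ≥0) ≤ t :=
  div_le_of_le_mul₀ zero_le zero_le (Nat.floor_le zero_le)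

lemma abs_sub_gridSum_le {ε : ℝ} {k : ℕ} (hε : 0 ≤ ε)
    (h : ∀ j < ⌊t * k⌋₊,
      |M ((j + 1) / k) - M (j / k) - f ((j + 1) / k) * (v ((j + 1) / k) - v (j / k))| ≤ ε / k) :
    |M (⌊t * k⌋₊ / k) - M 0 - gridSum f v k t| ≤ ε * t := by
  have htel : M (⌊t * k⌋₊ / k) - M 0 =
      ∑ j ∈ Finset.range ⌊t * k⌋₊, (M ((j + 1) / k) - M (j / k)) := by
    simpa using (Finset.sum_range_sub (fun j : ℕ => M (j / k)) ⌊t * k⌋₊).symm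
  have hle : (⌊t * k⌋₊ / k : ℝ) ≤ t := by exact_mod_cast floor_mul_div_le t k
  rw [htel, gridSum, ← Finset.sum_sub_distrib]
  calc _ ≤ ∑ _j ∈ Finset.range ⌊t * k⌋₊, ε / k :=
        (Finset.abs_sum_le_sum_abs _ _).trans
          (Finset.sum_le_sum fun j hj => h j (Finset.mem_range.1 hj))
    _ = ε * (⌊t * k⌋₊ / k) := by
        rw [Finset.sum_const, Finset.card_range, nsmul_eq_mul, mul_div_left_comm]
    _ ≤ ε * t := by gcongr

lemma tendsto_gridSum (hM : ContinuousAt M t)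
    (h : ∀ ε > 0, ∀ᶠ k : ℕ in atTop, ∀ j < ⌊t * k⌋₊,
      |M ((j + 1) / k) - M (j / k) - f ((j + 1) / k) * (v ((j + 1) / k) - v (j / k))| ≤ ε / k) :
    Tendsto (gridSum f v · t) atTop (𝓝 (M t - M 0)) := by
  have hgrid : Tendsto (fun k : ℕ => (⌊t * k⌋₊ / k : ℝ≥0)) atTop (𝓝 t) := by
    have hfloor (k : ℕ) : ⌊t * (k : ℝ≥0)⌋₊ = ⌊(t : ℝ) * k⌋₊ :=
      (Nonneg.nat_floor_coe (t * (k : ℝ≥0))).symm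
    refine NNReal.tendsto_coe.1 ?_
    simpa [hfloor, Function.comp_def] using
      (tendsto_nat_floor_mul_div_atTop t.coe_nonneg).comp tendsto_natCast_atTop_atTop
  refine tendsto_of_tendsto_of_dist ((hM.tendsto.comp hgrid).sub_const (M 0)) ?_
  refine Metric.tendsto_nhds.2 fun ε hε => ?_
  filter_upwards [h (ε / (t + 1)) (by positivity)] with k hk
  rw [Real.dist_0_eq_abs, abs_dist, Real.dist_eq]
  calc _ ≤ ε / (t + 1) * t := abs_sub_gridSum_le (by positivity) hk
    _ < ε := by rw [div_mul_comm, mul_lt_iff_lt_one_left hε, div_lt_one (by positivity)]; simp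

end GridSum

-- The error of one grid cell in `d(e^{κ s} z) = e^{κ s} (dz + κ z ds)`.
lemma abs_exp_mul_sub_le {κ ε : ℝ} {a b : ℝ} {z : ℝ → ℝ} (hz : Continuous z) (hab : a ≤ b)
    (hε : ∀ r ∈ Set.Icc a b, |κ * Real.exp (κ * r) * z a - κ * Real.exp (κ * b) * z r| ≤ ε) :
    |Real.exp (κ * b) * z b - Real.exp (κ * a) * z a -
      Real.exp (κ * b) * (z b - z a + κ * ∫ r in a..b, z r)| ≤ ε * (b - a) := by
  have hexp : ∫ r in a..b, κ * Real.exp (κ * r) = Real.exp (κ * b) - Real.exp (κ * a) := by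
    refine intervalIntegral.integral_eq_sub_of_hasDerivAt (f := fun r => Real.exp (κ * r))
      (fun r _ => ?_) (Continuous.intervalIntegrable (by fun_prop) _ _)
    simpa [mul_comm] using ((hasDerivAt_id r).const_mul κ).exp
  have hint : Real.exp (κ * b) * z b - Real.exp (κ * a) * z a -
      Real.exp (κ * b) * (z b - z a + κ * ∫ r in a..b, z r) =
      ∫ r in a..b, (κ * Real.exp (κ * r) * z a - κ * Real.exp (κ * b) * z r) := by
    rw [intervalIntegral.integral_sub (Continuous.intervalIntegrable (by fun_prop) _ _)
      (Continuous.intervalIntegrable (by fun_prop) _ _), intervalIntegral.integral_mul_const,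
      hexp, intervalIntegral.integral_const_mul]
    ring
  rw [hint, ← abs_of_nonneg (sub_nonneg.2 hab), ← Real.norm_eq_abs (∫ _ in a..b, _)]
  refine intervalIntegral.norm_integral_le_of_norm_le_const fun r hr => ?_
  rw [Set.uIoc_of_le hab] at hr
  exact hε r ⟨hr.1.le, hr.2⟩

lemma exists_forall_abs_exp_mul_sub_le (κ t : ℝ) {z : ℝ → ℝ} (hz : Continuous z)
    {ε : ℝ} (hε : 0 < ε) :
    ∃ δ > 0, ∀ a b, 0 ≤ a → a ≤ b → b ≤ t → b - a < δ →
      |Real.exp (κ * b) * z b - Real.exp (κ * a) * z a -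
        Real.exp (κ * b) * (z b - z a + κ * ∫ r in a..b, z r)| ≤ ε * (b - a) := by
  have hF : Continuous fun p : ℝ × ℝ => κ * Real.exp (κ * p.1) * z p.2 := by fun_prop
  have hU := (isCompact_Icc (a := (0 : ℝ)) (b := t)).prod (isCompact_Icc (a := (0 : ℝ)) (b := t))
    |>.uniformContinuousOn_of_continuous hF.continuousOn
  obtain ⟨δ, hδ, hU⟩ := Metric.uniformContinuousOn_iff.1 hU ε hε
  refine ⟨δ, hδ, fun a b ha hab hb hba => abs_exp_mul_sub_le hz hab fun r hr => ?_⟩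
  refine (hU (r, a) ⟨⟨ha.trans hr.1, hr.2.trans hb⟩, ⟨ha, hab.trans hb⟩⟩
    (b, r) ⟨⟨ha.trans hab, hb⟩, ⟨ha.trans hr.1, hr.2.trans hb⟩⟩ ?_).le
  rw [Prod.dist_eq, max_lt_iff, Real.dist_eq, Real.dist_eq, abs_lt, abs_lt]
  obtain ⟨har, hrb⟩ := hr
  constructor <;> constructor <;> linarith

lemma tendsto_gridSum_exp {κ σ : ℝ} {z v : ℝ≥0 → ℝ} (hz : Continuous z)
    (hv : ∀ s : ℝ≥0, z s = z 0 - κ * (∫ r in (0 : ℝ)..s, z r.toNNReal) + σ * v s)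
    (t : ℝ≥0) :
    Tendsto (gridSum (fun s => σ * Real.exp (κ * s)) v · t) atTop
      (𝓝 (Real.exp (κ * t) * z t - z 0)) := by
  have hz' : Continuous fun r : ℝ => z r.toNNReal := hz.comp continuous_real_toNNReal
  have hM : Continuous fun s : ℝ≥0 => Real.exp (κ * s) * z s := by fun_prop
  have hincr (a b : ℝ≥0) :
      σ * (v b - v a) = z b - z a + κ * ∫ r in (a : ℝ)..b, z r.toNNReal := by
    rw [← intervalIntegral.integral_interval_sub_left (hz'.intervalIntegrable 0 b)
      (hz'.intervalIntegrable 0 a)]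
    linear_combination hv a - hv b
  have hlim := tendsto_gridSum (f := fun s => σ * Real.exp (κ * s)) (v := v) (t := t)
    hM.continuousAt fun ε hε => ?_
  · simpa using hlim
  obtain ⟨δ, hδ, hloc⟩ := exists_forall_abs_exp_mul_sub_le κ t hz' hε
  filter_upwards [tendsto_one_div_atTop_nhds_zero_nat.eventually_lt_const hδ] with k hk j hj
  have hmesh : ((j + 1) / k : ℝ) - j / k = 1 / k := by ring
  have hbt : ((j + 1) / k : ℝ) ≤ t := by
    have hj' : (j + 1 : ℝ) ≤ ⌊t * k⌋₊ := by exact_mod_cast hj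
    have hle : (⌊t * k⌋₊ / k : ℝ) ≤ t := by exact_mod_cast floor_mul_div_le t k
    exact le_trans (by gcongr) hle
  have hstep := hloc (j / k) ((j + 1) / k) (by positivity) (by gcongr; linarith) hbt
    (hmesh.trans_lt hk)
  rw [hmesh, mul_one_div] at hstep
  convert hstep using 2
  have ha : (j / k : ℝ).toNNReal = j / k := by
    rw [Real.toNNReal_div (by positivity)]; simp
  have hb : ((j + 1) / k : ℝ).toNNReal = (j + 1) / k := by
    rw [Real.toNNReal_div (by positivity), Real.toNNReal_add (by positivity) zero_le_one]; simp
  rw [mul_comm σ, mul_assoc, hincr, ha, hb]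
  push_cast
  ring

section BrownianGridSum

variable {Ω : Type*} [MeasurableSpace Ω] {P : Measure Ω} {W : ℝ≥0 → Ω → ℝ} {Z : Ω → ℝ}

lemma covariance_grid_increments (hW : IsPreBrownianReal W P) (k i j : ℕ) :
    cov[W ((i + 1) / k) - W (i / k), W ((j + 1) / k) - W (j / k); P] =
      if i = j then 1 / (k : ℝ) else 0 := by
  have hP : IsProbabilityMeasure P := hW.isGaussianProcess.isProbabilityMeasure
  have hW2 t : MemLp (W t) 2 P := (hW.isGaussianProcess.hasGaussianLaw_eval t).memLp_two
  rw [covariance_sub_sub (hW2 _) (hW2 _) (hW2 _) (hW2 _)]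
  simp only [hW.covariance_eval, NNReal.coe_min, NNReal.coe_div, NNReal.coe_add, NNReal.coe_one,
    NNReal.coe_natCast, min_div_div_right k.cast_nonneg]
  norm_cast
  rcases lt_trichotomy i j with h | rfl | h
  · rw [if_neg h.ne, min_eq_left (by lia), min_eq_left (by lia), min_eq_left (by lia),
      min_eq_left (by lia)]
    ring
  · rw [if_pos rfl, min_self, min_self, min_eq_right (by lia), min_eq_left (by lia)]
    push_cast
    ring
  · rw [if_neg h.ne', min_eq_right (by lia), min_eq_right (by lia), min_eq_right (by lia),
      min_eq_right (by lia)]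
    ring

lemma covariance_gridSum (hW : IsPreBrownianReal W P) (f g : ℝ≥0 → ℝ) (k : ℕ) (s t : ℝ≥0) :
    cov[gridSum f W k s, gridSum g W k t; P] = gridSum (f * g) ((↑) : ℝ≥0 → ℝ) k (min s t) := by
  have hP : IsProbabilityMeasure P := hW.isGaussianProcess.isProbabilityMeasure
  have hW2 t : MemLp (W t) 2 P := (hW.isGaussianProcess.hasGaussianLaw_eval t).memLp_two
  have hterm (c : ℝ) (j : ℕ) : MemLp (c • (W ((j + 1) / k) - W (j / k))) 2 P :=
    ((hW2 _).sub (hW2 _)).const_smul c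
  have hfloor : ⌊min s t * k⌋₊ = min ⌊s * k⌋₊ ⌊t * k⌋₊ := by
    rw [← min_mul_mul_right]
    exact (Nat.floor_mono (R := ℝ≥0)).map_min
  rw [gridSum, gridSum, covariance_sum_sum' (fun j _ => hterm _ j) (fun j _ => hterm _ j)]
  simp only [covariance_smul_left, covariance_smul_right, covariance_grid_increments hW, mul_ite,
    mul_zero, Finset.sum_ite_eq, gridSum, hfloor]
  rw [← Finset.sum_filter]
  refine Finset.sum_congr (by ext; simp) fun j _ => ?_
  simp only [NNReal.coe_div, NNReal.coe_add, NNReal.coe_natCast, NNReal.coe_one, Pi.mul_apply,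
    smul_eq_mul, ← sub_div, add_sub_cancel_left]
  ring

lemma isGaussianProcess_add_gridSum (hW : IsPreBrownianReal W P) (hZ : HasGaussianLaw Z P)
    (hind : IndepFun Z (fun ω t => W t ω) P) (f : ℝ≥0 → ℝ) (k : ℕ) :
    IsGaussianProcess (fun t => Z + gridSum f W k t) P := by
  have hZproc : IsGaussianProcess (fun _ : Unit => Z) P :=
    isGaussianProcess_of_forall_sum fun I c => by
      simp_rw [← Finset.sum_mul]
      exact hZ.fun_smul _
  have hpair : IsGaussianProcess (Sum.elim (fun _ : Unit => Z) W) P :=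
    isGaussianProcess_sumElim hZproc hW.isGaussianProcess
      (hind.comp (φ := fun z (_ : Unit) => z) (ψ := id) (by fun_prop) measurable_id)
  refine isGaussianProcess_of_mem_span hpair fun t =>
    Submodule.add_mem _ (Submodule.subset_span ⟨.inl (), rfl⟩) ?_
  refine Submodule.span_mono ?_ (gridSum_mem_span f W k t)
  rintro _ ⟨s, rfl⟩
  exact ⟨.inr s, rfl⟩

lemma integral_add_gridSum (hW : IsPreBrownianReal W P) (hZ : Integrable Z P) (f : ℝ≥0 → ℝ)
    (k : ℕ) (t : ℝ≥0) : P[Z + gridSum f W k t] = P[Z] := by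
  have hterm (j : ℕ) :
      Integrable (f ((j + 1) / k) • (W ((j + 1) / k) - W (j / k))) P :=
    ((hW.integrable_eval _).sub (hW.integrable_eval _)).smul _
  have hincr (j : ℕ) : P[f ((j + 1) / k) • (W ((j + 1) / k) - W (j / k))] = 0 := by
    simp_rw [Pi.smul_apply, Pi.sub_apply, integral_smul,
      integral_sub (hW.integrable_eval _) (hW.integrable_eval _), hW.integral_eval, sub_zero,
      smul_zero]
  rw [gridSum, integral_add' hZ (integrable_finsetSum' _ fun j _ => hterm j)]
  simp_rw [Finset.sum_apply, integral_finsetSum _ fun j _ => hterm j, hincr,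
    Finset.sum_const_zero, add_zero]

lemma covariance_add_gridSum (hW : IsPreBrownianReal W P) (hZ : MemLp Z 2 P)
    (hind : IndepFun Z (fun ω t => W t ω) P) (f : ℝ≥0 → ℝ) (k : ℕ) (s t : ℝ≥0) :
    cov[Z + gridSum f W k s, Z + gridSum f W k t; P] =
      Var[Z; P] + gridSum (f * f) ((↑) : ℝ≥0 → ℝ) k (min s t) := by
  have hP : IsProbabilityMeasure P := hW.isGaussianProcess.isProbabilityMeasure
  have hS t : MemLp (gridSum f W k t) 2 P :=
    (hasGaussianLaw_of_mem_span hW.isGaussianProcess (gridSum_mem_span f W k t)).memLp_two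
  have hZS t : cov[Z, gridSum f W k t; P] = 0 := by
    have hmeas : Measurable fun w : ℝ≥0 → ℝ => gridSum f w k t := by
      unfold gridSum
      fun_prop
    have hindS : IndepFun Z (gridSum f W k t) P := by
      have heq : gridSum f W k t = (fun w => gridSum f w k t) ∘ fun ω t => W t ω :=
        funext (gridSum_apply f W k t)
      exact heq ▸ hind.comp measurable_id hmeas
    exact hindS.covariance_eq_zero hZ (hS t)
  rw [covariance_add_left hZ (hS s) (hZ.add (hS t)), covariance_add_right hZ hZ (hS t),
    covariance_add_right (hS s) hZ (hS t), covariance_self hZ.aemeasurable, hZS,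
    covariance_comm _ Z, hZS, covariance_gridSum hW]
  ring

lemma tendsto_covariance_add_gridSum_exp (hW : IsPreBrownianReal W P) (hZ : MemLp Z 2 P)
    (hind : IndepFun Z (fun ω t => W t ω) P) {κ σ : ℝ} (hκ : κ ≠ 0)
    (hZvar : Var[Z; P] = σ ^ 2 / (2 * κ)) (s t : ℝ≥0) :
    Tendsto (fun k => cov[Z + gridSum (fun s => σ * Real.exp (κ * s)) W k s,
      Z + gridSum (fun s => σ * Real.exp (κ * s)) W k t; P]) atTop
      (𝓝 (σ ^ 2 / (2 * κ) * Real.exp (2 * κ * (min s t : ℝ≥0)))) := by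
  have hsq : (fun s : ℝ≥0 => σ * Real.exp (κ * s)) * (fun s : ℝ≥0 => σ * Real.exp (κ * s)) =
      fun s : ℝ≥0 => σ ^ 2 * Real.exp (2 * κ * s) := by
    ext s
    rw [Pi.mul_apply, mul_assoc 2 κ, two_mul, Real.exp_add]
    ring
  simp_rw [covariance_add_gridSum hW hZ hind, hZvar, hsq]
  -- The constant `z = σ² / (2κ)` solves `dz = -2κ z ds + σ² ds`.
  have hlim := tendsto_gridSum_exp (κ := 2 * κ) (σ := σ ^ 2) (z := fun _ => σ ^ 2 / (2 * κ))
    (v := (↑)) continuous_const (fun s => by simp; field_simp; ring) (min s t)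
  convert hlim.const_add (σ ^ 2 / (2 * κ)) using 2
  ring

end BrownianGridSum

namespace IsStationaryOU

variable {Ω : Type*} [MeasurableSpace Ω] {P : Measure Ω} {κ θ σ : ℝ} {W X : ℝ≥0 → Ω → ℝ}

lemma tendsto_initial_add_gridSum (hX : IsStationaryOU κ θ σ W X P) :
    ∀ᵐ ω ∂P, ∀ t, Tendsto
      (fun k => X 0 ω - θ + gridSum (fun s => σ * Real.exp (κ * s)) W k t ω) atTop
      (𝓝 (Real.exp (κ * t) * (X t ω - θ))) := by
  filter_upwards [hX.continuous_paths, hX.sde] with ω hcont hsde t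
  have hdrift (s : ℝ≥0) : ∫ r in (0 : ℝ)..s, κ * (θ - X r.toNNReal ω) =
      -(κ * ∫ r in (0 : ℝ)..s, (X r.toNNReal ω - θ)) := by
    rw [← intervalIntegral.integral_const_mul, ← intervalIntegral.integral_neg]
    simp only [← mul_neg, neg_sub]
  have hlim := tendsto_gridSum_exp (κ := κ) (σ := σ) (z := fun s => X s ω - θ)
    (v := (W · ω)) (by fun_prop) (fun s => by linear_combination hsde s + hdrift s) t
  simpa only [gridSum_apply, add_sub_cancel] using hlim.const_add (X 0 ω - θ)

lemma isGaussianProcess_exp_mul_sub_and_covariance_eq (hκ : 0 < κ)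
    (hX : IsStationaryOU κ θ σ W X P) :
    IsGaussianProcess (fun (t : ℝ≥0) ω => Real.exp (κ * t) * (X t ω - θ)) P ∧
    ∀ s t : ℝ≥0, cov[fun ω => Real.exp (κ * s) * (X s ω - θ),
      fun ω => Real.exp (κ * t) * (X t ω - θ); P] =
        σ ^ 2 / (2 * κ) * Real.exp (2 * κ * (min s t : ℝ≥0)) := by
  have hW := hX.brownian.toIsPreBrownianReal
  let Z ω := X 0 ω - θ
  have hZlaw : HasLaw Z (gaussianReal 0 (σ ^ 2 / (2 * κ)).toNNReal) P := by
    simpa only [sub_self] using gaussianReal_sub_const hX.initial θ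
  have hZ := hZlaw.hasGaussianLaw
  have hZvar : Var[Z; P] = σ ^ 2 / (2 * κ) := by
    rw [hZlaw.variance_eq, variance_id_gaussianReal, Real.coe_toNNReal _ (by positivity)]
  have hind : IndepFun Z (fun ω t => W t ω) P :=
    hX.indep.comp (φ := fun x => x - θ) (ψ := id) (by fun_prop) measurable_id
  have hproc k := isGaussianProcess_add_gridSum hW hZ hind (fun s => σ * Real.exp (κ * s)) k
  have hlim t := hX.tendsto_initial_add_gridSum.mono fun ω hω => hω t
  have hmean t : Tendsto
      (fun k => P[Z + gridSum (fun s => σ * Real.exp (κ * s)) W k t]) atTop (𝓝 P[Z]) :=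
    tendsto_const_nhds.congr fun k => (integral_add_gridSum hW hZ.integrable _ k t).symm
  have hcov := tendsto_covariance_add_gridSum_exp hW hZ.memLp_two hind hκ.ne' hZvar
  exact ⟨isGaussianProcess_of_tendsto hproc hlim hmean hcov,
    covariance_eq_of_tendsto hproc hlim hmean hcov⟩

lemma isGaussianProcess (hκ : 0 < κ) (hX : IsStationaryOU κ θ σ W X P) :
    IsGaussianProcess X P := by
  have hrescale (t : ℝ≥0) (ω : Ω) :
      Real.exp (-(κ * t)) * (Real.exp (κ * t) * (X t ω - θ)) + θ = X t ω := by
    rw [← mul_assoc, ← Real.exp_add, neg_add_cancel, Real.exp_zero, one_mul, sub_add_cancel]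
  obtain ⟨hG, -⟩ := hX.isGaussianProcess_exp_mul_sub_and_covariance_eq hκ
  simpa only [smul_eq_mul, hrescale] using
    isGaussianProcess_add_const (hG.smul fun t : ℝ≥0 => Real.exp (-(κ * t))) θ

lemma covariance_eq (hκ : 0 < κ) (hX : IsStationaryOU κ θ σ W X P) (s t : ℝ≥0) :
    cov[X s, X t; P] = σ ^ 2 / (2 * κ) * Real.exp (-(κ * |(s : ℝ) - t|)) := by
  have hP : IsProbabilityMeasure P := (hX.isGaussianProcess hκ).isProbabilityMeasure
  have hint (s : ℝ≥0) : Integrable (X s) P :=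
    ((hX.isGaussianProcess hκ).hasGaussianLaw_eval s).integrable
  have h := (hX.isGaussianProcess_exp_mul_sub_and_covariance_eq hκ).2 s t
  rw [covariance_const_mul_left, covariance_const_mul_right, covariance_sub_const_left (hint s),
    covariance_sub_const_right (hint t)] at h
  have hmin : 2 * (min s t : ℝ≥0) = (s : ℝ) + t - |(s : ℝ) - t| := by
    rw [NNReal.coe_min, ← min_add_max, ← max_sub_min_eq_abs']
    ring
  have hexp : Real.exp (2 * κ * (min s t : ℝ≥0)) =
      Real.exp (κ * s) * (Real.exp (κ * t) * Real.exp (-(κ * |(s : ℝ) - t|))) := by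
    rw [← Real.exp_add, ← Real.exp_add]
    congr 1
    linear_combination κ * hmin
  refine mul_left_cancel₀ (Real.exp_ne_zero (κ * s)) <|
    mul_left_cancel₀ (Real.exp_ne_zero (κ * t)) ?_
  linear_combination h + σ ^ 2 / (2 * κ) * hexp

lemma variance_eq (hκ : 0 < κ) (hX : IsStationaryOU κ θ σ W X P) (t : ℝ≥0) :
    Var[X t; P] = σ ^ 2 / (2 * κ) := by
  rw [← covariance_self (hX.aemeasurable t), hX.covariance_eq hκ, sub_self, abs_zero, mul_zero,
    neg_zero, Real.exp_zero, mul_one]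

end IsStationaryOU

section MutualInfo

variable {Ω E : Type*} [MeasurableSpace Ω] [MeasurableSpace E] {P : Measure Ω}

lemma mutualInfo_ne_top_and_toReal_eq_integral_log [IsProbabilityMeasure P] {F : Type*}
    [MeasurableSpace F] {U : Ω → F} {V : Ω → E} (hU : AEMeasurable U P) (hV : AEMeasurable V P)
    {f : F × E → ℝ≥0∞} (hf : Measurable f)
    (hlaw : P.map (fun ω => (U ω, V ω)) = ((P.map U).prod (P.map V)).withDensity f)
    (hint : Integrable (fun ω => Real.log (f (U ω, V ω)).toReal) P) :
    mutualInfo U V P ≠ ∞ ∧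
      (mutualInfo U V P).toReal = ∫ ω, Real.log (f (U ω, V ω)).toReal ∂P := by
  have hUV : AEMeasurable (fun ω => (U ω, V ω)) P := hU.prodMk hV
  have := Measure.isProbabilityMeasure_map hU
  have := Measure.isProbabilityMeasure_map hV
  have := Measure.isProbabilityMeasure_map hUV
  have hac : P.map (fun ω => (U ω, V ω)) ≪ (P.map U).prod (P.map V) :=
    hlaw ▸ withDensity_absolutelyContinuous _ _
  have hllr : llr (P.map fun ω => (U ω, V ω)) ((P.map U).prod (P.map V))
      =ᵐ[P.map fun ω => (U ω, V ω)] fun p => Real.log (f p).toReal := by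
    have hdens := Measure.rnDeriv_withDensity ((P.map U).prod (P.map V)) hf
    rw [← hlaw] at hdens
    filter_upwards [hac.ae_le hdens] with p hp
    rw [llr, hp]
  have hlog : AEStronglyMeasurable (fun p => Real.log (f p).toReal)
      (P.map fun ω => (U ω, V ω)) := (by fun_prop : Measurable _).aestronglyMeasurable
  have hint' := (integrable_congr hllr).2 ((integrable_map_measure hlog hUV).2 hint)
  refine ⟨InformationTheory.klDiv_ne_top hac hint', ?_⟩
  rw [mutualInfo, InformationTheory.toReal_klDiv hac hint', integral_congr_ae hllr,
    integral_map hUV hlog]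
  simp only [probReal_univ, add_sub_cancel_right]

/-- The density of `gaussianReal μ v` with respect to `gaussianReal μ' v'`, for `v, v' ≠ 0`. -/
noncomputable def gaussianDensityRatio (μ : ℝ) (v : ℝ≥0) (μ' : ℝ) (v' : ℝ≥0) (x : ℝ) : ℝ≥0∞ :=
  gaussianPDF μ v x / gaussianPDF μ' v' x

lemma measurable_gaussianDensityRatio {μ : E → ℝ} (hμ : Measurable μ) (v : ℝ≥0) (μ' : ℝ)
    (v' : ℝ≥0) : Measurable fun p : ℝ × E => gaussianDensityRatio (μ p.2) v μ' v' p.1 := by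
  unfold gaussianDensityRatio gaussianPDF gaussianPDFReal
  fun_prop

lemma withDensity_gaussianDensityRatio (μ μ' : ℝ) {v v' : ℝ≥0} (hv : v ≠ 0) (hv' : v' ≠ 0) :
    (gaussianReal μ' v').withDensity (gaussianDensityRatio μ v μ' v') = gaussianReal μ v := by
  have hmeas : Measurable (gaussianDensityRatio μ v μ' v') :=
    (measurable_gaussianPDF μ v).div (measurable_gaussianPDF μ' v')
  rw [gaussianReal_of_var_ne_zero _ hv, gaussianReal_of_var_ne_zero _ hv',
    ← withDensity_mul _ (measurable_gaussianPDF _ _) hmeas]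
  congr 1
  ext x
  exact ENNReal.mul_div_cancel (gaussianPDF_pos _ hv' x).ne' (by simp [gaussianPDF])

lemma log_toReal_gaussianDensityRatio (μ μ' : ℝ) {v v' : ℝ≥0} (hv : v ≠ 0) (hv' : v' ≠ 0)
    (x : ℝ) : Real.log (gaussianDensityRatio μ v μ' v' x).toReal =
      1 / 2 * Real.log (v' / v) - (x - μ) ^ 2 / (2 * v) + (x - μ') ^ 2 / (2 * v') := by
  have hlog (a : ℝ) {u : ℝ≥0} (hu : u ≠ 0) : Real.log (gaussianPDFReal a u x) =
      -(1 / 2 * (Real.log (2 * Real.pi) + Real.log u)) - (x - a) ^ 2 / (2 * u) := by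
    have hu' : (0 : ℝ) < u := by positivity
    rw [gaussianPDFReal, Real.log_mul (by positivity) (by positivity), Real.log_exp,
      Real.log_inv, Real.log_sqrt (by positivity), Real.log_mul (by positivity) hu'.ne']
    ring
  rw [gaussianDensityRatio, ENNReal.toReal_div, toReal_gaussianPDF, toReal_gaussianPDF,
    Real.log_div (gaussianPDFReal_pos _ _ _ hv).ne' (gaussianPDFReal_pos _ _ _ hv').ne',
    hlog μ hv, hlog μ' hv', Real.log_div (by positivity) (by positivity)]
  ring

variable {U R : Ω → ℝ} {V : Ω → E} {L : E → ℝ} {μ ν : ℝ} {v w : ℝ≥0}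

lemma map_prodMk_eq_withDensity_gaussianDensityRatio [IsFiniteMeasure P] (hL : Measurable L)
    (hV : AEMeasurable V P) (hv : v ≠ 0) (hw : w ≠ 0) (hU : HasLaw U (gaussianReal μ v) P)
    (hR : HasLaw R (gaussianReal ν w) P) (hind : IndepFun R V P)
    (hUR : ∀ ω, U ω = L (V ω) + R ω) :
    P.map (fun ω => (U ω, V ω)) = ((P.map U).prod (P.map V)).withDensity
      fun p => gaussianDensityRatio (ν + L p.2) w μ v p.1 := by
  have hRV := (indepFun_iff_map_prod_eq_prod_map_map hR.aemeasurable hV).1 hind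
  have hf := measurable_gaussianDensityRatio (hL.const_add ν) w μ v
  refine Measure.ext_of_lintegral _ fun g hg => ?_
  have hg' : Measurable fun p : ℝ × E => g (L p.2 + p.1, p.2) := by fun_prop
  have hslice (y : E) : ∫⁻ x, gaussianDensityRatio (ν + L y) w μ v x * g (x, y) ∂P.map U =
      ∫⁻ x, g (L y + x, y) ∂P.map R := by
    have hgy : Measurable fun x => g (x, y) := by fun_prop
    have hratio : Measurable (gaussianDensityRatio (ν + L y) w μ v) :=
      (measurable_gaussianPDF _ _).div (measurable_gaussianPDF _ _)
    rw [hU.map_eq, hR.map_eq, ← lintegral_map (g := fun x => L y + x) hgy (by fun_prop),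
      gaussianReal_map_const_add, ← withDensity_gaussianDensityRatio (ν + L y) μ hw hv,
      lintegral_withDensity_eq_lintegral_mul _ hratio hgy]
    rfl
  calc ∫⁻ p, g p ∂P.map (fun ω => (U ω, V ω))
      = ∫⁻ p, g (L p.2 + p.1, p.2) ∂P.map (fun ω => (R ω, V ω)) := by
        rw [lintegral_map' hg.aemeasurable (hU.aemeasurable.prodMk hV),
          lintegral_map' hg'.aemeasurable (hR.aemeasurable.prodMk hV)]
        simp only [hUR]
    _ = ∫⁻ y, ∫⁻ x, g (L y + x, y) ∂P.map R ∂P.map V := by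
        rw [hRV, lintegral_prod_symm' _ hg']
    _ = ∫⁻ y, ∫⁻ x, gaussianDensityRatio (ν + L y) w μ v x * g (x, y) ∂P.map U ∂P.map V := by
        simp only [hslice]
    _ = _ := by
        rw [lintegral_withDensity_eq_lintegral_mul _ hf hg,
          lintegral_prod_symm' _ (hf.mul hg)]
        rfl

lemma mutualInfo_ne_top_and_toReal_eq_log_variance_div [IsProbabilityMeasure P]
    (hL : Measurable L) (hV : AEMeasurable V P) (hU : HasGaussianLaw U P)
    (hR : HasGaussianLaw R P) (hUvar : 0 < Var[U; P]) (hRvar : 0 < Var[R; P])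
    (hind : IndepFun R V P) (hUR : ∀ ω, U ω = L (V ω) + R ω) :
    mutualInfo U V P ≠ ∞ ∧
      (mutualInfo U V P).toReal = 1 / 2 * Real.log (Var[U; P] / Var[R; P]) := by
  have hv := (Real.toNNReal_pos.2 hUvar).ne'
  have hw := (Real.toNNReal_pos.2 hRvar).ne'
  have hUsq : Integrable (fun ω => (U ω - P[U]) ^ 2) P :=
    (hU.memLp_two.sub (memLp_const _)).integrable_sq
  have hRsq : Integrable (fun ω => (R ω - P[R]) ^ 2) P :=
    (hR.memLp_two.sub (memLp_const _)).integrable_sq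
  have hlog (ω : Ω) : Real.log (gaussianDensityRatio (P[R] + L (V ω)) Var[R; P].toNNReal P[U]
      Var[U; P].toNNReal (U ω)).toReal = 1 / 2 * Real.log (Var[U; P] / Var[R; P]) -
        (R ω - P[R]) ^ 2 / (2 * Var[R; P]) + (U ω - P[U]) ^ 2 / (2 * Var[U; P]) := by
    rw [log_toReal_gaussianDensityRatio _ _ hw hv, Real.coe_toNNReal _ hUvar.le,
      Real.coe_toNNReal _ hRvar.le, hUR]
    ring
  have hint : Integrable (fun ω => 1 / 2 * Real.log (Var[U; P] / Var[R; P]) -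
      (R ω - P[R]) ^ 2 / (2 * Var[R; P])) P :=
    (integrable_const _).sub (hRsq.div_const _)
  obtain ⟨hfin, hval⟩ := mutualInfo_ne_top_and_toReal_eq_integral_log hU.aemeasurable hV
    (measurable_gaussianDensityRatio (hL.const_add _) _ _ _)
    (map_prodMk_eq_withDensity_gaussianDensityRatio hL hV hv hw
      ⟨hU.aemeasurable, hU.map_eq_gaussianReal⟩ ⟨hR.aemeasurable, hR.map_eq_gaussianReal⟩ hind hUR)
    ((integrable_congr (.of_forall hlog)).2 (hint.add (hUsq.div_const _)))
  refine ⟨hfin, hval.trans ?_⟩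
  simp only [hlog]
  rw [integral_add hint (hUsq.div_const _), integral_sub (integrable_const _) (hRsq.div_const _),
    integral_div, integral_div, ← variance_eq_integral hU.aemeasurable,
    ← variance_eq_integral hR.aemeasurable, integral_const, probReal_univ, one_smul]
  field_simp
  ring

end MutualInfo

section AddNoise

variable {Ω T ι : Type*} [MeasurableSpace Ω] {P : Measure Ω} {X : T → Ω → ℝ} {N : ι → Ω → ℝ}
  {v : ℝ≥0} [IsProbabilityMeasure P] (hX : ∀ t, MemLp (X t) 2 P)
  (hN : ∀ i, HasLaw (N i) (gaussianReal 0 v) P)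
  (hXN : IndepFun (fun ω t => X t ω) (fun ω i => N i ω) P)

include hX hN hXN

lemma covariance_add_noise_left (s : ι → T) (i : ι) (t : T) :
    cov[X (s i) + N i, X t; P] = cov[X (s i), X t; P] := by
  have hN2 := (hN i).hasGaussianLaw.memLp_two
  have hind : IndepFun (X t) (N i) P := hXN.comp (measurable_pi_apply t) (measurable_pi_apply i)
  rw [covariance_add_left (hX _) hN2 (hX t), covariance_comm (N i),
    hind.covariance_eq_zero (hX t) hN2, add_zero]

lemma covariance_add_noise [DecidableEq ι] (hNind : iIndepFun N P) (s : ι → T) :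
    (Matrix.of fun i j => cov[X (s i) + N i, X (s j) + N j; P]) =
      (Matrix.of fun i j => cov[X (s i), X (s j); P]) + (v : ℝ) • 1 := by
  have hN2 i := (hN i).hasGaussianLaw.memLp_two
  have hnoise i j : cov[N i, N j; P] = ((v : ℝ) • (1 : Matrix ι ι ℝ)) i j := by
    rcases eq_or_ne i j with rfl | hij
    · simp [covariance_self (hN i).aemeasurable, (hN i).variance_eq]
    · simp [hij, (hNind.indepFun hij).covariance_eq_zero (hN2 i) (hN2 j)]
  have hcross i j : cov[X (s i), N j; P] = 0 :=
    (hXN.comp (measurable_pi_apply (s i)) (measurable_pi_apply j)).covariance_eq_zero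
      (hX _) (hN2 j)
  ext i j
  rw [Matrix.of_apply, covariance_add_right ((hX _).add (hN2 i)) (hX _) (hN2 j),
    covariance_add_noise_left hX hN hXN, covariance_add_left (hX _) (hN2 i) (hN2 j), hcross,
    zero_add, hnoise]
  rfl

end AddNoise

section Regression

open Matrix

variable {Ω T ι : Type*} [MeasurableSpace Ω] [Fintype ι] {P : Measure Ω}

section Residual

variable {G : T → Ω → ℝ} (hG : IsGaussianProcess G P) {U : Ω → ℝ} {V : ι → Ω → ℝ}
  (hU : U ∈ Submodule.span ℝ (Set.range G)) (hV : ∀ i, V i ∈ Submodule.span ℝ (Set.range G))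
  {c : ι → ℝ} (hc : (of fun i j => cov[V i, V j; P]) *ᵥ c = fun i => cov[V i, U; P])

include hG hU hV

lemma hasGaussianLaw_sub_sum (c : ι → ℝ) : HasGaussianLaw (U - ∑ i, c i • V i) P :=
  hasGaussianLaw_of_mem_span hG <| Submodule.sub_mem _ hU <|
    Submodule.sum_mem _ fun i _ => Submodule.smul_mem _ _ (hV i)

lemma covariance_sub_sum {Z : Ω → ℝ} (hZ : MemLp Z 2 P) (c : ι → ℝ) :
    cov[Z, U - ∑ i, c i • V i; P] = cov[Z, U; P] - (fun i => cov[Z, V i; P]) ⬝ᵥ c := by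
  have hP : IsProbabilityMeasure P := hG.isProbabilityMeasure
  have hcV i : MemLp (c i • V i) 2 P :=
    (hasGaussianLaw_of_mem_span hG (hV i)).memLp_two.const_smul _
  rw [covariance_sub_right hZ (hasGaussianLaw_of_mem_span hG hU).memLp_two
    (memLp_finsetSum' _ fun i _ => hcV i), covariance_sum_right hcV hZ]
  simp only [covariance_smul_right, dotProduct, mul_comm]

include hc

lemma covariance_sub_sum_eq_zero (i : ι) : cov[V i, U - ∑ j, c j • V j; P] = 0 := by
  rw [covariance_sub_sum hG hU hV (hasGaussianLaw_of_mem_span hG (hV i)).memLp_two,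
    ← congrFun hc i]
  exact sub_self _

lemma variance_sub_sum :
    Var[U - ∑ i, c i • V i; P] = Var[U; P] - c ⬝ᵥ fun i => cov[V i, U; P] := by
  have hR := hasGaussianLaw_sub_sum hG hU hV c
  have hU' := hasGaussianLaw_of_mem_span hG hU
  rw [← covariance_self hR.aemeasurable, covariance_sub_sum hG hU hV hR.memLp_two,
    covariance_comm _ U, covariance_sub_sum hG hU hV hU'.memLp_two,
    covariance_self hU'.aemeasurable, dotProduct_comm]
  simp only [covariance_comm (U - _), covariance_sub_sum_eq_zero hG hU hV hc, covariance_comm U,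
    ← Pi.zero_def, zero_dotProduct, sub_zero]

lemma indepFun_sub_sum : IndepFun (U - ∑ i, c i • V i) (fun ω i => V i ω) P := by
  have hR : U - ∑ i, c i • V i ∈ Submodule.span ℝ (Set.range G) :=
    Submodule.sub_mem _ hU <| Submodule.sum_mem _ fun i _ => Submodule.smul_mem _ _ (hV i)
  have hpair : IsGaussianProcess (Sum.elim (fun _ : Unit => U - ∑ i, c i • V i) V) P :=
    isGaussianProcess_of_mem_span hG (Sum.rec (fun _ => hR) hV)
  have hind := hpair.indepFun_of_covariance_eq_zero
    (fun _ => (hasGaussianLaw_of_mem_span hG hR).aemeasurable)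
    (fun i => (hasGaussianLaw_of_mem_span hG (hV i)).aemeasurable)
    fun _ i => (covariance_comm _ _).trans (covariance_sub_sum_eq_zero hG hU hV hc i)
  exact hind.comp (measurable_pi_apply ()) measurable_id

lemma mutualInfo_ne_top_and_toReal_eq_log_of_mulVec_eq (hUvar : 0 < Var[U; P])
    (hres : 0 < Var[U; P] - c ⬝ᵥ fun i => cov[V i, U; P]) :
    mutualInfo U (fun ω i => V i ω) P ≠ ∞ ∧
      (mutualInfo U (fun ω i => V i ω) P).toReal =
        1 / 2 * Real.log (Var[U; P] / (Var[U; P] - c ⬝ᵥ fun i => cov[V i, U; P])) := by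
  have hP : IsProbabilityMeasure P := hG.isProbabilityMeasure
  rw [← variance_sub_sum hG hU hV hc] at hres ⊢
  refine mutualInfo_ne_top_and_toReal_eq_log_variance_div (L := fun y => ∑ i, c i * y i)
    (by fun_prop) ?_ (hasGaussianLaw_of_mem_span hG hU) (hasGaussianLaw_sub_sum hG hU hV c)
    hUvar hres (indepFun_sub_sum hG hU hV hc) fun ω => ?_
  · exact aemeasurable_pi_lambda _ fun i => (hasGaussianLaw_of_mem_span hG (hV i)).aemeasurable
  · simp

end Residual

lemma isGaussianProcess_of_iIndepFun {N : T → Ω → ℝ} (hN : ∀ t, HasGaussianLaw (N t) P)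
    (h : iIndepFun N P) : IsGaussianProcess N P where
  hasGaussianLaw I := (h.precomp (g := ((↑) : I → T)) Subtype.val_injective).hasGaussianLaw
    fun t => hN t

lemma mutualInfo_add_noise_ne_top_and_toReal_eq_log [DecidableEq ι] {X : T → Ω → ℝ}
    {N : ι → Ω → ℝ} {v : ℝ≥0} (hX : IsGaussianProcess X P)
    (hN : ∀ i, HasLaw (N i) (gaussianReal 0 v) P) (hNind : iIndepFun N P)
    (hXN : IndepFun (fun ω t => X t ω) (fun ω i => N i ω) P) (s : ι → T) (t : T) {c : ι → ℝ}
    (hc : ((of fun i j => cov[X (s i), X (s j); P]) + (v : ℝ) • 1) *ᵥ c =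
      fun i => cov[X (s i), X t; P])
    (hvar : 0 < Var[X t; P]) (hres : 0 < Var[X t; P] - c ⬝ᵥ fun i => cov[X (s i), X t; P]) :
    mutualInfo (X t) (fun ω i => X (s i) ω + N i ω) P ≠ ∞ ∧
      (mutualInfo (X t) (fun ω i => X (s i) ω + N i ω) P).toReal =
        1 / 2 * Real.log (Var[X t; P] / (Var[X t; P] - c ⬝ᵥ fun i => cov[X (s i), X t; P])) := by
  have hP : IsProbabilityMeasure P := hX.isProbabilityMeasure
  have hX2 t : MemLp (X t) 2 P := (hX.hasGaussianLaw_eval t).memLp_two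
  have hG : IsGaussianProcess (Sum.elim X N) P := isGaussianProcess_sumElim hX
    (isGaussianProcess_of_iIndepFun (fun i => (hN i).hasGaussianLaw) hNind) hXN
  have hY i : X (s i) + N i ∈ Submodule.span ℝ (Set.range (Sum.elim X N)) :=
    Submodule.add_mem _ (Submodule.subset_span ⟨.inl (s i), rfl⟩)
      (Submodule.subset_span ⟨.inr i, rfl⟩)
  have hcross i := covariance_add_noise_left hX2 hN hXN s i t
  simp only [← hcross, ← covariance_add_noise hX2 hN hXN hNind] at hc hres ⊢
  exact mutualInfo_ne_top_and_toReal_eq_log_of_mulVec_eq hG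
    (Submodule.subset_span ⟨.inl t, rfl⟩) hY hc hvar hres

end Regression

section MatrixFacts

open Matrix

lemma sum_Iic_cons_sub {M : Type*} [AddCommGroup M] {m : ℕ} (p : Fin (m + 1) → M)
    (i : Fin (m + 1)) :
    ∑ l ∈ Finset.Iic i, (Fin.cons (p 0) fun j => p j.succ - p j.castSucc : Fin (m + 1) → M) l =
      p i := by
  induction i using Fin.induction with
  | zero => rw [show Finset.Iic (0 : Fin (m + 1)) = {0} from Finset.Iic_bot]; simp
  | succ i ih =>
    have hIic : Finset.Iic i.succ = insert i.succ (Finset.Iic i.castSucc) := by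
      ext l
      simp only [Finset.mem_Iic, Finset.mem_insert, Fin.le_def, Fin.ext_iff, Fin.val_succ,
        Fin.val_castSucc]
      lia
    rw [hIic, Finset.sum_insert (by simp), ih, Fin.cons_succ, sub_add_cancel]

-- `p (min i j)` is the covariance matrix of partial sums of independent variables, whose
-- variances `d` are the increments of `p`.
lemma posDef_of_min {m : ℕ} {p : Fin (m + 1) → ℝ} (hp : StrictMono p) (hp0 : 0 < p 0) :
    (of fun i j => p (min i j)).PosDef := by
  let d : Fin (m + 1) → ℝ := Fin.cons (p 0) fun j => p j.succ - p j.castSucc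
  have hd : ∀ l, 0 < d l := Fin.cases hp0 fun j => sub_pos.2 (hp j.castSucc_lt_succ)
  let B : Matrix (Fin (m + 1)) (Fin (m + 1)) ℝ := of fun i l => if l ≤ i then 1 else 0
  have hdet : B.det = 1 := by
    rw [det_of_isLowerTriangular B fun i j hij => if_neg (not_le.2 hij)]
    simp [B]
  have hB : IsUnit B := B.isUnit_iff_isUnit_det.2 (hdet ▸ isUnit_one)
  have hfactor : (of fun i j => p (min i j)) = B * diagonal d * star B := by
    ext i j
    have hIic : Finset.Iic (min i j) = Finset.univ.filter fun l => l ≤ i ∧ l ≤ j := by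
      ext l
      simp
    rw [of_apply, ← sum_Iic_cons_sub p (min i j), hIic, Finset.sum_filter, mul_apply]
    refine Finset.sum_congr rfl fun l _ => ?_
    simp only [mul_diagonal, star_apply, star_trivial, B, of_apply, ite_and, mul_ite, ite_mul,
      one_mul, mul_one, zero_mul, mul_zero]
    split_ifs <;> rfl
  rw [hfactor, IsUnit.posDef_star_right_conjugate_iff hB]
  exact PosDef.diagonal hd

lemma posDef_exp_neg_mul_abs_sub {κ : ℝ} (hκ : 0 < κ) {m : ℕ} {s : Fin (m + 1) → ℝ}
    (hs : StrictMono s) : (of fun i j => Real.exp (-(κ * |s i - s j|))).PosDef := by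
  have hp : StrictMono fun i => Real.exp (2 * κ * s i) := fun i j hij => by
    have := hs hij
    dsimp only
    gcongr
  -- The stationary Ornstein–Uhlenbeck process is a time-changed Brownian motion.
  have hconj : (of fun i j => Real.exp (-(κ * |s i - s j|))) =
      diagonal (fun i => Real.exp (-(κ * s i))) * (of fun i j => Real.exp (2 * κ * s (min i j))) *
        star (diagonal fun i => Real.exp (-(κ * s i))) := by
    ext i j
    have hmin : 2 * s (min i j) = s i + s j - |s i - s j| := by
      rw [hs.monotone.map_min, ← min_add_max, ← max_sub_min_eq_abs']
      ring
    simp only [star_eq_conjTranspose, diagonal_conjTranspose, mul_diagonal, diagonal_mul, of_apply,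
      star_trivial, ← Real.exp_add]
    congr 1
    linear_combination -κ * hmin
  have hunit : IsUnit (diagonal fun i => Real.exp (-(κ * s i))) := by
    rw [isUnit_diagonal, Pi.isUnit_iff]
    exact fun i => (Real.exp_ne_zero _).isUnit
  rw [hconj, IsUnit.posDef_star_right_conjugate_iff hunit]
  exact posDef_of_min hp (Real.exp_pos _)

lemma inv_last_last_eq_det_removeLast_div {m : ℕ} (A : Matrix (Fin (m + 1)) (Fin (m + 1)) ℝ) :
    A⁻¹ (Fin.last m) (Fin.last m) = (removeLast A).det / A.det := by
  rw [inv_def, Matrix.smul_apply, adjugate_fin_succ_eq_det_submatrix, Ring.inverse_eq_inv',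
    smul_eq_mul, Fin.succAbove_last, Even.neg_one_pow (Even.add_self _), one_mul, div_eq_inv_mul]
  rfl

variable {ι : Type*} [Fintype ι] [DecidableEq ι] {S : Matrix ι ι ℝ} {v : ℝ}

lemma posDef_smul_inv_add_one (hS : S.PosDef) (hv : 0 ≤ v) : (v • S⁻¹ + 1).PosDef :=
  PosDef.one.posSemidef_add (hS.inv.posSemidef.smul hv)

lemma add_smul_one_mul_inv (hS : S.PosDef) (hv : 0 ≤ v) :
    (S + v • 1) * (v • S⁻¹ + 1)⁻¹ = S := by
  have hSdet := S.isUnit_iff_isUnit_det.1 hS.isUnit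
  have hAdet := (isUnit_iff_isUnit_det _).1 (posDef_smul_inv_add_one hS hv).isUnit
  have hSA : S + v • 1 = S * (v • S⁻¹ + 1) := by
    rw [Matrix.mul_add, Matrix.mul_smul, mul_nonsing_inv _ hSdet, Matrix.mul_one, add_comm]
  rw [hSA, mul_nonsing_inv_cancel_right _ _ hAdet]

lemma add_smul_one_mulVec_col_inv (hS : S.PosDef) (hv : 0 ≤ v) (l : ι) :
    (S + v • 1) *ᵥ (v • S⁻¹ + 1)⁻¹.col l = S.col l := by
  rw [← mulVec_single_one, mulVec_mulVec, add_smul_one_mul_inv hS hv, mulVec_single_one]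

lemma col_inv_dotProduct_col (hS : S.PosDef) (hv : 0 ≤ v) (l : ι) :
    (v • S⁻¹ + 1)⁻¹.col l ⬝ᵥ S.col l = S l l - v * (v • S⁻¹ + 1)⁻¹ l l := by
  have h := congrFun (add_smul_one_mulVec_col_inv hS hv l) l
  have hsymm : S.col l = S l := funext fun i => by simpa using hS.isHermitian.apply l i
  rw [add_mulVec, smul_mulVec, one_mulVec] at h
  rw [dotProduct_comm, hsymm]
  exact eq_sub_of_add_eq h

end MatrixFacts

section MarkovObservations

open Matrix

variable {Ω T ι : Type*} [MeasurableSpace Ω] [Fintype ι] [DecidableEq ι] {P : Measure Ω}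
  {X : T → Ω → ℝ} {N : ι → Ω → ℝ} {v : ℝ≥0}

lemma mutualInfo_add_noise_of_covariance_eq_mul (hX : IsGaussianProcess X P)
    (hN : ∀ i, HasLaw (N i) (gaussianReal 0 v) P) (hNind : iIndepFun N P)
    (hXN : IndepFun (fun ω t => X t ω) (fun ω i => N i ω) P) {s : ι → T} {t : T} {l : ι}
    {S : Matrix ι ι ℝ} (hS : S = of fun i j => cov[X (s i), X (s j); P]) (hSpos : S.PosDef)
    {e : ℝ} (he : e ≠ 0) (hv : v ≠ 0) (ht : ∀ i, cov[X (s i), X t; P] = e * S i l) :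
    mutualInfo (X t) (fun ω i => X (s i) ω + N i ω) P ≠ ∞ ∧
      (mutualInfo (X t) (fun ω i => X (s i) ω + N i ω) P).toReal =
        1 / 2 * Real.log (Var[X t; P] /
          (Var[X t; P] - e ^ 2 * (S l l - v * ((v : ℝ) • S⁻¹ + 1)⁻¹ l l))) := by
  have hP : IsProbabilityMeasure P := hX.isProbabilityMeasure
  have hX2 t : MemLp (X t) 2 P := (hX.hasGaussianLaw_eval t).memLp_two
  have hv0 : (0 : ℝ) < v := by positivity
  let A := (v : ℝ) • S⁻¹ + 1
  have hAll : 0 < A⁻¹ l l := (posDef_smul_inv_add_one hSpos hv0.le).inv.diag_pos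
  have hk : (fun i => cov[X (s i), X t; P]) = e • S.col l := funext ht
  have hc : (S + (v : ℝ) • 1) *ᵥ (e • A⁻¹.col l) = e • S.col l := by
    rw [mulVec_smul, add_smul_one_mulVec_col_inv hSpos hv0.le]
  have hdot : (e • A⁻¹.col l) ⬝ᵥ (e • S.col l) = e ^ 2 * (S l l - v * A⁻¹ l l) := by
    rw [smul_dotProduct, dotProduct_smul, col_inv_dotProduct_col hSpos hv0.le, smul_eq_mul,
      smul_eq_mul, ← mul_assoc, sq]
  have hSll : Var[X (s l); P] = S l l := by
    rw [hS, of_apply, covariance_self (hX2 _).aemeasurable]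
  have hcond : 0 ≤ Var[X t; P] - e ^ 2 * S l l := by
    have h := variance_nonneg (X t - e • X (s l)) P
    rw [variance_sub (hX2 t) ((hX2 _).const_smul e), variance_smul, covariance_smul_right,
      covariance_comm, ht, hSll] at h
    linarith
  have hsig : 0 < e ^ 2 * S l l := by have := hSpos.diag_pos (i := l); positivity
  have hnoise : 0 < e ^ 2 * (v * A⁻¹ l l) := by positivity
  have h := mutualInfo_add_noise_ne_top_and_toReal_eq_log hX hN hNind hXN s t
    (c := e • A⁻¹.col l) (by rw [← hS, hk, hc]) (by linarith) (by rw [hk, hdot]; linarith)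
  rwa [hk, hdot] at h

end MarkovObservations

section WindowIndex

variable {n m : ℕ}

lemma windowIndex_mem_Icc (hmn : m ≤ n) (j : Fin m) : windowIndex n m j ∈ Set.Icc 1 n := by
  rw [windowIndex, Set.mem_Icc]
  lia

lemma windowIndex_last (hmn : m + 1 ≤ n) : windowIndex n (m + 1) (Fin.last m) = n := by
  rw [windowIndex, Fin.val_last]
  lia

lemma strictMono_windowIndex : StrictMono (windowIndex n m) := fun i j hij => by
  simpa only [windowIndex, add_lt_add_iff_left, Fin.val_fin_lt] using hij

end WindowIndex

section SampledOrnsteinUhlenbeck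

variable {Ω : Type*} [MeasurableSpace Ω] {P : Measure Ω} {κ θ σ σn : ℝ}
  {W X N : ℝ≥0 → Ω → ℝ} {n m : ℕ} {τ τ' : ℕ → ℝ≥0} {t : ℝ≥0}

lemma IsChannelNoise.variance_eq (hN : IsChannelNoise σn n τ' X N P) {i : ℕ}
    (hi : i ∈ Set.Icc 1 n) : Var[N (τ' i); P] = σn ^ 2 := by
  rw [(hN.law i hi).variance_eq, variance_id_gaussianReal, Real.coe_toNNReal _ (sq_nonneg σn)]

lemma posDef_sampleCovariance (hκ : 0 < κ) (hσ : σ ≠ 0) (hX : IsStationaryOU κ θ σ W X P)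
    (hmn : m + 1 ≤ n) (hτ : StrictMonoOn τ (Set.Icc 1 n)) :
    (sampleCovariance n (m + 1) τ X P).PosDef := by
  have hmono : StrictMono fun j => (τ (windowIndex n (m + 1) j) : ℝ) := fun i j hij =>
    hτ (windowIndex_mem_Icc hmn i) (windowIndex_mem_Icc hmn j) (strictMono_windowIndex hij)
  have hr : 0 < σ ^ 2 / (2 * κ) := by positivity
  have hcov : sampleCovariance n (m + 1) τ X P = (σ ^ 2 / (2 * κ)) • Matrix.of fun i j =>
      Real.exp (-(κ * |(τ (windowIndex n (m + 1) i) : ℝ) - τ (windowIndex n (m + 1) j)|)) :=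
    Matrix.ext fun i j => hX.covariance_eq hκ _ _
  rw [hcov]
  exact (posDef_exp_neg_mul_abs_sub hκ hmono).smul hr

lemma covariance_windowIndex_eq_exp_mul (hκ : 0 < κ) (hX : IsStationaryOU κ θ σ W X P)
    (hmn : m + 1 ≤ n) (hτ : MonotoneOn τ (Set.Icc 1 n)) (ht : τ n ≤ t) (j : Fin (m + 1)) :
    cov[X (τ (windowIndex n (m + 1) j)), X t; P] =
      Real.exp (-(κ * (t - τ n))) * sampleCovariance n (m + 1) τ X P j (Fin.last m) := by
  have hj := windowIndex_mem_Icc hmn j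
  have hjn : τ (windowIndex n (m + 1) j) ≤ τ n := hτ hj (Set.right_mem_Icc.2 (hj.1.trans hj.2)) hj.2
  rw [sampleCovariance, Matrix.of_apply, windowIndex_last hmn, hX.covariance_eq hκ,
    hX.covariance_eq hκ, abs_sub_comm, abs_sub_comm _ (τ n : ℝ), mul_left_comm, ← Real.exp_add,
    abs_of_nonneg (sub_nonneg.2 (NNReal.coe_le_coe.2 (hjn.trans ht))),
    abs_of_nonneg (sub_nonneg.2 (NNReal.coe_le_coe.2 hjn))]
  ring_nf

lemma valueOfInformation_ne_top_and_toReal_eq_log (hκ : 0 < κ) (hσ : σ ≠ 0) (hσn : σn ≠ 0)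
    (hX : IsStationaryOU κ θ σ W X P) (hN : IsChannelNoise σn n τ' X N P) (hmn : m + 1 ≤ n)
    (hτ : StrictMonoOn τ (Set.Icc 1 n)) (ht : τ n ≤ t) :
    valueOfInformation n (m + 1) τ τ' X N P t ≠ ∞ ∧
      (valueOfInformation n (m + 1) τ τ' X N P t).toReal =
        1 / 2 * Real.log (σ ^ 2 / (2 * κ) / (σ ^ 2 / (2 * κ) -
          Real.exp (-(2 * κ * (t - τ n))) * (σ ^ 2 / (2 * κ) -
            σn ^ 2 * (matrixA σn n (m + 1) τ X P)⁻¹ (Fin.last m) (Fin.last m)))) := by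
  let window (j : Fin (m + 1)) : Set.Icc 1 n :=
    ⟨windowIndex n (m + 1) j, windowIndex_mem_Icc hmn j⟩
  have hwindow : Function.Injective window := fun i j hij =>
    strictMono_windowIndex.injective (congrArg Subtype.val hij)
  have hmain := mutualInfo_add_noise_of_covariance_eq_mul (hX.isGaussianProcess hκ)
    (fun j => hN.law (window j) (window j).2) (hN.iIndep.precomp hwindow)
    (hN.indep.comp measurable_id (measurable_pi_lambda _ fun j => measurable_pi_apply (window j)))
    (s := fun j => τ (window j)) (t := t) (S := sampleCovariance n (m + 1) τ X P) rfl
    (posDef_sampleCovariance hκ hσ hX hmn hτ) (Real.exp_ne_zero _)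
    (Real.toNNReal_pos.2 (by positivity)).ne'
    (covariance_windowIndex_eq_exp_mul hκ hX hmn hτ.monotoneOn ht)
  have hlast : sampleCovariance n (m + 1) τ X P (Fin.last m) (Fin.last m) = σ ^ 2 / (2 * κ) := by
    simp [sampleCovariance, hX.covariance_eq hκ]
  have hexp : Real.exp (-(κ * (t - τ n))) ^ 2 = Real.exp (-(2 * κ * (t - τ n))) := by
    rw [← Real.exp_nat_mul]
    push_cast
    ring_nf
  rwa [hX.variance_eq hκ, hexp, hlast, Real.coe_toNNReal _ (sq_nonneg σn)] at hmain

end SampledOrnsteinUhlenbeck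

lemma log_div_sub_exp_neg_mul {r s D x : ℝ} (hr : 0 < r) (hs : 0 < s) (hD : 0 < D) (hx : 0 < x) :
    Real.log (r / (r - Real.exp (-x) * (r - s * D))) =
      Real.log (1 / (1 - Real.exp (-x))) -
        Real.log (1 + 1 / (Real.exp x - 1) * (D / (r / s))) := by
  have hexp : 0 < Real.exp x - 1 := sub_pos.2 (Real.one_lt_exp_iff.2 hx)
  have hexp_neg : 0 < 1 - Real.exp (-x) := sub_pos.2 (Real.exp_lt_one_iff.2 (neg_lt_zero.2 hx))
  have hfactor : r - Real.exp (-x) * (r - s * D) =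
      r * ((1 - Real.exp (-x)) * (1 + 1 / (Real.exp x - 1) * (D / (r / s)))) := by
    rw [Real.exp_neg]
    field_simp
    ring
  rw [hfactor, div_mul_cancel_left₀ hr.ne', mul_inv, ← div_eq_mul_inv, ← one_div,
    Real.log_div (by positivity) (by positivity)]

theorem proposition1_general {Ω : Type*} [MeasurableSpace Ω] {P : Measure Ω}
    {κ θ σ σn : ℝ} (hκ : 0 < κ) (hσ : σ ≠ 0) (hσn : σn ≠ 0)
    {n m : ℕ} (hm : 1 ≤ m) (hmn : m ≤ n) {τ τ' : ℕ → ℝ≥0} {t : ℝ≥0}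
    (hτ : StrictMonoOn τ (Set.Icc 1 n)) (ht : τ n < t) {W X N : ℝ≥0 → Ω → ℝ}
    (hX : IsStationaryOU κ θ σ W X P) (hN : IsChannelNoise σn n τ' X N P)
    {γ : ℝ} (hγ : γ = σ ^ 2 / (2 * κ * σn ^ 2)) :
    (∀ i ∈ Set.Icc 1 n, Var[X (τ i); P] / Var[N (τ' i); P] = γ) ∧
    (sampleCovariance n m τ X P).det ≠ 0 ∧
    (matrixA σn n m τ X P).det ≠ 0 ∧
    valueOfInformation n m τ τ' X N P t ≠ ∞ ∧
    (valueOfInformation n m τ τ' X N P t).toReal =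
      1 / 2 * Real.log (1 / (1 - Real.exp (-2 * κ * ((t : ℝ) - (τ n : ℝ)))))
        - 1 / 2 * Real.log (1 + 1 / (Real.exp (2 * κ * ((t : ℝ) - (τ n : ℝ))) - 1)
            * ((removeLast (matrixA σn n m τ X P)).det
                / (γ * (matrixA σn n m τ X P).det))) := by
  obtain ⟨m, rfl⟩ := Nat.exists_eq_add_of_le' hm
  rw [← div_div] at hγ
  have hS := posDef_sampleCovariance hκ hσ hX hmn hτ
  have hA : (matrixA σn n (m + 1) τ X P).PosDef := posDef_smul_inv_add_one hS (sq_nonneg σn)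
  obtain ⟨hfinite, hvalue⟩ :=
    valueOfInformation_ne_top_and_toReal_eq_log hκ hσ hσn hX hN hmn hτ ht.le
  refine ⟨fun i hi => ?_, hS.det_pos.ne', hA.det_pos.ne', hfinite, ?_⟩
  · rw [hX.variance_eq hκ, hN.variance_eq hi, hγ]
  · have hx : 0 < 2 * κ * ((t : ℝ) - τ n) := mul_pos (by positivity) (sub_pos.2 ht)
    rw [hvalue, log_div_sub_exp_neg_mul (by positivity) (by positivity) hA.inv.diag_pos hx,
      inv_last_last_eq_det_removeLast_div, ← hγ, div_div, mul_comm _ γ, mul_sub, neg_mul, neg_mul]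

theorem proposition1 {Ω : Type*} [MeasurableSpace Ω] (P : Measure Ω) [IsProbabilityMeasure P]
    (κ θ σ σn : ℝ) (hκ : 0 < κ) (hσ : 0 < σ) (hσn : 0 < σn)
    (n m : ℕ) (hm : 1 ≤ m) (hmn : m ≤ n)
    (τ τ' : ℕ → ℝ≥0) (t : ℝ≥0)
    (hτ : StrictMonoOn τ (Set.Icc 1 n)) (hτ' : StrictMonoOn τ' (Set.Icc 1 n))
    (hdelay : ∀ i ∈ Set.Icc 1 n, τ i < τ' i) (ht : τ' n < t)
    (W X N : ℝ≥0 → Ω → ℝ)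
    (hX : IsStationaryOU κ θ σ W X P) (hN : IsChannelNoise σn n τ' X N P)
    (γ : ℝ) (hγ : γ = σ ^ 2 / (2 * κ * σn ^ 2)) :
    (∀ i ∈ Set.Icc 1 n, Var[X (τ i); P] / Var[N (τ' i); P] = γ) ∧
    (sampleCovariance n m τ X P).det ≠ 0 ∧
    (matrixA σn n m τ X P).det ≠ 0 ∧
    valueOfInformation n m τ τ' X N P t ≠ ∞ ∧
    (valueOfInformation n m τ τ' X N P t).toReal =
      1 / 2 * Real.log (1 / (1 - Real.exp (-2 * κ * ((t : ℝ) - (τ n : ℝ)))))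
        - 1 / 2 * Real.log (1 + 1 / (Real.exp (2 * κ * ((t : ℝ) - (τ n : ℝ))) - 1)
            * ((removeLast (matrixA σn n m τ X P)).det
                / (γ * (matrixA σn n m τ X P).det))) := by
  have hn : n ∈ Set.Icc 1 n := Set.right_mem_Icc.2 (hm.trans hmn)
  exact proposition1_general hκ hσ.ne' hσn.ne' hm hmn hτ ((hdelay n hn).trans ht) hX hN hγ
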